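/- **Theorem 1.** Let $(a(n))_{n\ge 0}$ be Stern's sequence: $a(0)=0$, $a(1)=1$, $a(2n)=a(n)$ and $a(2n+1)=a(n)+a(n+1)$ for $n\ge 0$. A record-setter is an index $v\geq 0$ such that $a(i)<a(v)$ for all $0\le i<v$; for $k\ge 1$ it is a $k$-bit record-setter if moreover $2^{k-1}\le v<2^k$. For a string $x$, write $x^i$ for the concatenation of $i$ copies of $x$. For $1\le k<12$, the $k$-bit record-setters, in increasing order, are the following numbers. - $k=1$: $1$; - $k=2$: $3$; - $k=3$: $5$; - $k=4$: $9$, $11$; - $k=5$: $19$, $21$; - $k=6$: $35$, $37$, $43$; - $k=7$: $69$, $73$, $75$, $83$, $85$; - $k=8$: $139$, $147$, $149$, $165$, $171$; - $k=9$: $277$, $293$, $299$, $331$, $339$, $341$; - $k=10$: $555$, $587$, $595$, $597$, $661$, $683$; - $k=11$: $1109$, $1173$, $1189$, $1195$, $1323$, $1355$, $1363$, $1365$. In base $2$ they are, respectively, $$\begin{array}{c|l} k & k\text{-bit record-setters in base } 2\\ \hline 1 & 1 \\ 2 & 11 \\ 3 & 101 \\ 4 & 1001, 1011 \\ 5 &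 10011, 10101 \\ 6 & 100011, 100101, 101011 \\ 7 & 1000101, 1001001, 1001011, 1010011, 1010101 \\ 8 & 10001011, 10010011, 10010101, 10100101, 10101011 \\ 9 & 100010101, 100100101, 100101011, 101001011, 101010011, 101010101 \\ 10 & 1000101011, 1001001011, 1001010011, 1001010101, 1010010101, 1010101011 \\ 11 & 10001010101, 10010010101, 10010100101, 10010101011, 10100101011, 10101001011, 10101010011, 10101010101 \\ \end{array}$$ For $k\ge 12$, the $k$-bit record-setters, listed in increasing order, have the following representations in base $2$. - If $k=2n$ is even: $$\begin{cases}100\,(10)^a\,0\,(10)^{n-3-a}\,11, & \text{for } 0\le a\le n-3;\\ (10)^b\,0\,(10)^{n-b-1}\,1, & \text{for } 1\le b\le \lfloor n/2\rfloor;\\ (10)^{n-1}\,11.\end{cases}$$ - If $k=2n+1$ is odd: $$\begin{cases}1000\,(10)^{n-2}\,1;\\ 100100\,(10)^{n-4}\,011;\\ 100\,(10)^b\,0\,(10)^{n-2-b}\,1, & \text{for } 1\le b\le \lceil n/2\rceil-1;\\ (10)^{a+1}\,0\,(10)^{n-2-a}\,11, & \text{for } 0\le a\le n-2;\\ (10)^n\,1.\end{cases}$$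 In each case the rows are taken in the order shown, and within a row the parameter $a$ or $b$ increases. In particular, for $k\ge 12$, the number of $k$-bit record-setters is $\lfloor 3k/4\rfloor-(-1)^k$. -/

import Mathlib

/-- Stern's diatomic sequence: `a(0) = 0`, `a(1) = 1`, `a(2n) = a(n)`,
`a(2n+1) = a(n) + a(n+1)`; see `stern_two_mul` and `stern_two_mul_add_one`. -/
def stern : ℕ → ℕ
  | 0 => 0
  | 1 => 1
  | m + 2 =>
    if (m + 2) % 2 = 0 then stern ((m + 2) / 2)
    else stern ((m + 2) / 2) + stern ((m + 2) / 2 + 1)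
  termination_by n => n
  decreasing_by all_goals omega

theorem stern_zero : stern 0 = 0 := by rw [stern]

theorem stern_one : stern 1 = 1 := by rw [stern]

theorem stern_two_mul (n : ℕ) : stern (2 * n) = stern n := by
  obtain _ | n := n
  · rfl
  · rw [show 2 * (n + 1) = 2 * n + 2 by ring, stern, if_pos (by omega)]
    congr 1
    omega

theorem stern_two_mul_add_one (n : ℕ) : stern (2 * n + 1) = stern n + stern (n + 1) := by
  obtain _ | n := n
  · simp [stern_zero, stern_one]
  · rw [show 2 * (n + 1) + 1 = (2 * n + 1) + 2 by ring, stern, if_neg (by omega),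
      show (2 * n + 1 + 2) / 2 = n + 1 by omega]

/-- An index `v` is a record-setter of the sequence `s` if `s i < s v` for all `i < v`. -/
def IsRecordSetter (s : ℕ → ℕ) (v : ℕ) : Prop := ∀ i < v, s i < s v

instance decidableIsRecordSetter (s : ℕ → ℕ) : DecidablePred (IsRecordSetter s) := fun v =>
  inferInstanceAs (Decidable (∀ i < v, s i < s v))

/-- The `k`-bit record-setters of Stern's sequence (`k ≥ 1`), that is, the record-setters
in the interval `[2^(k-1), 2^k)`. -/
def recordSetters (k : ℕ) : Finset ℕ :=
  (Finset.Ico (2 ^ (k - 1)) (2 ^ k)).filter (IsRecordSetter stern)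

/-- The `k`-bit record-setters of Stern's sequence, listed in increasing order. -/
def recordSetterList (k : ℕ) : List ℕ := (recordSetters k).sort (· ≤ ·)

/-- The base-2 representation of a number, most significant digit first. -/
def binRep (v : ℕ) : List ℕ := (Nat.digits 2 v).reverse

/-- The string `(10)^i`, that is, `i` copies of the block `10`. -/
def tens (i : ℕ) : List ℕ := (List.replicate i [1, 0]).flatten

/-- The strings for `k = 2n` (`n ≥ 6`), in the order listed:
`100 (10)^a 0 (10)^(n-3-a) 11` for `0 ≤ a ≤ n-3`;
`(10)^b 0 (10)^(n-b-1) 1` for `1 ≤ b ≤ ⌊n/2⌋`;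
`(10)^(n-1) 11`. -/
def evenStrings (n : ℕ) : List (List ℕ) :=
  (List.range (n - 3 + 1)).map
      (fun a => [1, 0, 0] ++ tens a ++ [0] ++ tens (n - 3 - a) ++ [1, 1]) ++
  (List.range' 1 (n / 2)).map
      (fun b => tens b ++ [0] ++ tens (n - b - 1) ++ [1]) ++
  [tens (n - 1) ++ [1, 1]]

/-- The strings for `k = 2n+1` (`n ≥ 6`), in the order listed:
`1000 (10)^(n-2) 1`;
`100100 (10)^(n-4) 011`;
`100 (10)^b 0 (10)^(n-2-b) 1` for `1 ≤ b ≤ ⌈n/2⌉ - 1`, where `⌈n/2⌉ = (n + 1) / 2`;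
`(10)^(a+1) 0 (10)^(n-2-a) 11` for `0 ≤ a ≤ n-2`;
`(10)^n 1`. -/
def oddStrings (n : ℕ) : List (List ℕ) :=
  [[1, 0, 0, 0] ++ tens (n - 2) ++ [1]] ++
  [[1, 0, 0, 1, 0, 0] ++ tens (n - 4) ++ [0, 1, 1]] ++
  (List.range' 1 ((n + 1) / 2 - 1)).map
      (fun b => [1, 0, 0] ++ tens b ++ [0] ++ tens (n - 2 - b) ++ [1]) ++
  (List.range (n - 2 + 1)).map
      (fun a => tens (a + 1) ++ [0] ++ tens (n - 2 - a) ++ [1, 1]) ++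
  [tens n ++ [1]]

/-- The table of the `k`-bit record-setters for `1 ≤ k < 12`: for each `k`, in increasing
order, the base-2 representation and the numerical value. -/
def smallTable : ℕ → List (List ℕ × ℕ)
  | 1 => [([1], 1)]
  | 2 => [([1, 1], 3)]
  | 3 => [([1, 0, 1], 5)]
  | 4 => [([1, 0, 0, 1], 9),
      ([1, 0, 1, 1], 11)]
  | 5 => [([1, 0, 0, 1, 1], 19),
      ([1, 0, 1, 0, 1], 21)]
  | 6 => [([1, 0, 0, 0, 1, 1], 35),
      ([1, 0, 0, 1, 0, 1], 37),
      ([1, 0, 1, 0, 1, 1], 43)]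
  | 7 => [([1, 0, 0, 0, 1, 0, 1], 69),
      ([1, 0, 0, 1, 0, 0, 1], 73),
      ([1, 0, 0, 1, 0, 1, 1], 75),
      ([1, 0, 1, 0, 0, 1, 1], 83),
      ([1, 0, 1, 0, 1, 0, 1], 85)]
  | 8 => [([1, 0, 0, 0, 1, 0, 1, 1], 139),
      ([1, 0, 0, 1, 0, 0, 1, 1], 147),
      ([1, 0, 0, 1, 0, 1, 0, 1], 149),
      ([1, 0, 1, 0, 0, 1, 0, 1], 165),
      ([1, 0, 1, 0, 1, 0, 1, 1], 171)]
  | 9 => [([1, 0, 0, 0, 1, 0, 1, 0, 1], 277),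
      ([1, 0, 0, 1, 0, 0, 1, 0, 1], 293),
      ([1, 0, 0, 1, 0, 1, 0, 1, 1], 299),
      ([1, 0, 1, 0, 0, 1, 0, 1, 1], 331),
      ([1, 0, 1, 0, 1, 0, 0, 1, 1], 339),
      ([1, 0, 1, 0, 1, 0, 1, 0, 1], 341)]
  | 10 => [([1, 0, 0, 0, 1, 0, 1, 0, 1, 1], 555),
      ([1, 0, 0, 1, 0, 0, 1, 0, 1, 1], 587),
      ([1, 0, 0, 1, 0, 1, 0, 0, 1, 1], 595),
      ([1, 0, 0, 1, 0, 1, 0, 1, 0, 1], 597),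
      ([1, 0, 1, 0, 0, 1, 0, 1, 0, 1], 661),
      ([1, 0, 1, 0, 1, 0, 1, 0, 1, 1], 683)]
  | 11 => [([1, 0, 0, 0, 1, 0, 1, 0, 1, 0, 1], 1109),
      ([1, 0, 0, 1, 0, 0, 1, 0, 1, 0, 1], 1173),
      ([1, 0, 0, 1, 0, 1, 0, 0, 1, 0, 1], 1189),
      ([1, 0, 0, 1, 0, 1, 0, 1, 0, 1, 1], 1195),
      ([1, 0, 1, 0, 0, 1, 0, 1, 0, 1, 1], 1323),
      ([1, 0, 1, 0, 1, 0, 0, 1, 0, 1, 1], 1355),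
      ([1, 0, 1, 0, 1, 0, 1, 0, 0, 1, 1], 1363),
      ([1, 0, 1, 0, 1, 0, 1, 0, 1, 0, 1], 1365)]
  | _ => []

/-! Appending a binary digit to `n` acts linearly on the pair (`stern n`, `stern (n + 1)`). Over all
ways to append `m` digits, the resulting values of `stern` are bounded by a form with Fibonacci
coefficients, and alternating digits attain the bound (`stern_le_fib`, `exists_stern_eq_fib`). So a
record-setter must beat the Fibonacci optimum available after turning any of its 1s, except the last
digit, into 0 (`IsRecordSetter.fib_lt`).

Necessity: a record-setter is odd and has no 11 except at the end, so it is a word in the blocks 10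
and 0 followed by 1 or 11. Comparing the required lower bound with the upper bound for the digits
after a given prefix shows that too many blocks 0 cost too much. `IsRecordSetter.shape` leaves at
most two of them, apart from one family with three, and `IsRecordSetter.le_of_false` restricts their
position when the word ends in a single 1.

Sufficiency: among the surviving words of a given length `k`, index and `stern` value increase
together, and the first value exceeds `Nat.fib k`, a bound for `stern` below `2 ^ (k - 1)`. By
`recordSetterList_eq_of_isChain` all of them are then record-setters. The finitely many `k < 12` are
computed. -/

/-! ### Linear action of digits and Fibonacci bounds -/

theorem stern_four_mul_add_two (q : ℕ) : stern (4 * q + 2) = stern q + stern (q + 1) := by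
  rw [show 4 * q + 2 = 2 * (2 * q + 1) by ring, stern_two_mul, stern_two_mul_add_one]

theorem stern_four_mul_add_three (q : ℕ) : stern (4 * q + 3) = stern q + 2 * stern (q + 1) := by
  rw [show 4 * q + 3 = 2 * (2 * q + 1) + 1 by ring, stern_two_mul_add_one, stern_two_mul_add_one,
    show 2 * q + 1 + 1 = 2 * (q + 1) by ring, stern_two_mul]
  ring

/-- Both sides obey the same recurrence when `r` is halved. An odd `r` splits into two neighbours
`q` and `q + 1`, which is why `r = 2 ^ m` is admitted. -/
theorem stern_two_pow_mul_add (m : ℕ) : ∀ n r : ℕ, r ≤ 2 ^ m →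
    stern (2 ^ m * n + r) = stern (2 ^ m - r) * stern n + stern r * stern (n + 1) := by
  induction m with
  | zero =>
    intro n r hr
    have : r = 0 ∨ r = 1 := by simp at hr; omega
    rcases this with rfl | rfl <;> simp [stern_zero, stern_one]
  | succ m ih =>
    intro n r hr
    rw [pow_succ] at hr
    obtain ⟨q, rfl | rfl⟩ := Nat.even_or_odd' r
    · rw [show 2 ^ (m + 1) * n + 2 * q = 2 * (2 ^ m * n + q) by ring,
        show 2 ^ (m + 1) - 2 * q = 2 * (2 ^ m - q) by rw [pow_succ]; omega,
        stern_two_mul, stern_two_mul, stern_two_mul, ih n q (by omega)]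
    · rw [show 2 ^ (m + 1) * n + (2 * q + 1) = 2 * (2 ^ m * n + q) + 1 by ring,
        show 2 ^ (m + 1) - (2 * q + 1) = 2 * (2 ^ m - (q + 1)) + 1 by rw [pow_succ]; omega,
        stern_two_mul_add_one, stern_two_mul_add_one, stern_two_mul_add_one, ih n q (by omega),
        add_assoc (2 ^ m * n), ih n (q + 1) (by omega),
        show 2 ^ m - (q + 1) + 1 = 2 ^ m - q by omega]
      ring

/-- A bound on the values of `stern` at the numbers whose binary expansion extends that of `n` by `m` bits. -/
theorem stern_le_fib (m : ℕ) : ∀ n r M N : ℕ, r < 2 ^ m → stern n ≤ M → stern (n + 1) ≤ M →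
    stern n + stern (n + 1) ≤ M + N →
    stern (2 ^ m * n + r) ≤ Nat.fib (m + 1) * M + Nat.fib m * N := by
  induction m with
  | zero =>
    intro n r M N hr h1 _ _
    have : r = 0 := by simpa using hr
    subst this
    simpa using h1
  | succ m ih =>
    intro n r M N hr h1 h2 h3
    -- One digit replaces an entry of the pair by the sum of both, so the bounds `(M, N)` become `(M
    -- + N, M)`.
    have key : Nat.fib (m + 1) * (M + N) + Nat.fib m * M =
        Nat.fib (m + 1 + 1) * M + Nat.fib (m + 1) * N := by
      rw [Nat.fib_add_two]; ring
    rw [← key]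
    rw [pow_succ] at hr
    have e1 := stern_two_mul n
    have e2 := stern_two_mul_add_one n
    have e3 : stern (2 * n + 1 + 1) = stern (n + 1) := by
      rw [show 2 * n + 1 + 1 = 2 * (n + 1) by ring, stern_two_mul]
    by_cases h : r < 2 ^ m
    · rw [show 2 ^ (m + 1) * n + r = 2 ^ m * (2 * n) + r by ring]
      exact ih (2 * n) r (M + N) M h (by omega) (by omega) (by omega)
    · obtain ⟨q, rfl⟩ := Nat.exists_eq_add_of_le (not_lt.mp h)
      rw [show 2 ^ (m + 1) * n + (2 ^ m + q) = 2 ^ m * (2 * n + 1) + q by ring]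
      exact ih (2 * n + 1) q (M + N) M (by omega) (by omega) (by omega) (by omega)

theorem stern_le_fib_of_lt {m r : ℕ} (h : r < 2 ^ m) : stern r ≤ Nat.fib (m + 1) := by
  simpa [stern_zero, stern_one] using stern_le_fib m 0 r 1 0 h

/-- Alternating digits attain the bound of `stern_le_fib`. The two halves belong to the tails
starting with 1 and with 0; each digit exchanges the roles of the two entries, so they are proved
together. -/
theorem exists_stern_eq_fib (m : ℕ) : ∀ n : ℕ,
    (∃ r < 2 ^ (m + 1), stern (2 ^ (m + 1) * n + r) =
      Nat.fib (m + 2) * stern (n + 1) + Nat.fib (m + 1) * stern n) ∧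
    (∃ r < 2 ^ (m + 1), stern (2 ^ (m + 1) * n + r) =
      Nat.fib (m + 2) * stern n + Nat.fib (m + 1) * stern (n + 1)) := by
  induction m with
  | zero =>
    intro n
    refine ⟨⟨1, by norm_num, ?_⟩, ⟨1, by norm_num, ?_⟩⟩ <;>
      (simp [stern_two_mul_add_one]; try omega)
  | succ m ih =>
    intro n
    have e1 := stern_two_mul n
    have e2 := stern_two_mul_add_one n
    have e3 : stern (2 * n + 1 + 1) = stern (n + 1) := by
      rw [show 2 * n + 1 + 1 = 2 * (n + 1) by ring, stern_two_mul]
    have hf : Nat.fib (m + 1 + 2) = Nat.fib (m + 1) + Nat.fib (m + 2) := Nat.fib_add_two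
    obtain ⟨r, hr, h⟩ := (ih (2 * n + 1)).2
    obtain ⟨r', hr', h'⟩ := (ih (2 * n)).1
    constructor
    · refine ⟨2 ^ (m + 1) + r, by rw [pow_succ _ (m + 1)]; omega, ?_⟩
      rw [show 2 ^ (m + 1 + 1) * n + (2 ^ (m + 1) + r) = 2 ^ (m + 1) * (2 * n + 1) + r by ring, h,
        e2, e3, hf]
      ring
    · refine ⟨r', by rw [pow_succ _ (m + 1)]; omega, ?_⟩
      rw [show 2 ^ (m + 1 + 1) * n + r' = 2 ^ (m + 1) * (2 * n) + r' by ring, h', e1, e2, hf]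
      ring

/-! ### First constraints on record-setters -/

/-- A record-setter beats every smaller number obtained by switching one binary digit `1` to `0`
and changing the digits after it. -/
theorem IsRecordSetter.fib_lt {v : ℕ} (hv : IsRecordSetter stern v) {m p r : ℕ}
    (h : v = 2 ^ (m + 1) * (2 * p + 1) + r) :
    Nat.fib (m + 2) * (stern p + stern (p + 1)) + Nat.fib (m + 1) * stern p < stern v := by
  obtain ⟨r', hr', e⟩ := (exists_stern_eq_fib m (2 * p)).1
  rw [stern_two_mul, stern_two_mul_add_one] at e
  rw [← e]
  apply hv
  rw [h, show 2 ^ (m + 1) * (2 * p + 1) = 2 ^ (m + 1) * (2 * p) + 2 ^ (m + 1) by ring]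
  omega

theorem IsRecordSetter.odd {v : ℕ} (hv : IsRecordSetter stern v) (h0 : v ≠ 0) : v % 2 = 1 := by
  by_contra h
  obtain ⟨q, rfl⟩ : ∃ q, v = 2 * q := ⟨v / 2, by omega⟩
  have := hv q (by omega)
  rw [stern_two_mul] at this
  exact lt_irrefl _ this

/-- Apart from the last two digits, the binary expansion of a record-setter contains no `11`. -/
theorem IsRecordSetter.not_one_one {v : ℕ} (hv : IsRecordSetter stern v) (m : ℕ) :
    v / 2 / 2 ^ m % 4 ≠ 3 := by
  intro h
  have h0 : v ≠ 0 := by rintro rfl; simp at h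
  have hodd := hv.odd h0
  obtain ⟨w, rfl⟩ : ∃ w, v = 2 * w + 1 := ⟨v / 2, by omega⟩
  rw [show (2 * w + 1) / 2 = w by omega] at h
  have ht := Nat.mod_lt w (show 0 < 2 ^ m by positivity)
  have hw := Nat.div_add_mod w (2 ^ m)
  obtain ⟨p, hp⟩ : ∃ p, w / 2 ^ m = 4 * p + 3 := ⟨w / 2 ^ m / 4, by omega⟩
  set t := w % 2 ^ m
  rw [hp] at hw
  have e1 : 2 * w + 1 = 2 ^ (m + 1) * (4 * p + 3) + (2 * t + 1) := by rw [← hw]; ring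
  have hle : 2 * t + 1 ≤ 2 ^ (m + 1) := by rw [pow_succ]; omega
  -- Reflecting the tail `r` to `2 ^ (m + 1) - r` swaps its two coefficients. With `a = stern p` and
  -- `b = stern (p + 1)`, the swap matches the entry `a + 2b` on both sides and replaces `b` by `a +
  -- b`, so the smaller number has at least the same value.
  have hlt : 2 ^ (m + 1) * (4 * p + 2) + (2 ^ (m + 1) - (2 * t + 1)) < 2 * w + 1 := by
    rw [e1, show 2 ^ (m + 1) * (4 * p + 3) = 2 ^ (m + 1) * (4 * p + 2) + 2 ^ (m + 1) by ring]
    omega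
  have := hv _ hlt
  rw [e1, stern_two_pow_mul_add _ _ _ hle, stern_two_pow_mul_add _ _ _ (Nat.sub_le _ _),
    Nat.sub_sub_self hle, stern_four_mul_add_three, stern_four_mul_add_two,
    show 4 * p + 3 + 1 = 2 * (2 * (p + 1)) by ring, stern_two_mul,
    stern_two_mul] at this
  nlinarith [Nat.zero_le (stern (2 * t + 1) * stern p)]

/-! ### Words in the blocks 10 and 0 -/

/-- The number whose binary expansion is the concatenation of the blocks `10` (for `true`)
and `0` (for `false`). -/
def blockVal (T : List Bool) : ℕ := T.foldl (fun q t => if t then 4 * q + 2 else 2 * q) 0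

/-- The number of binary digits in a list of blocks. -/
def blockLen : List Bool → ℕ
  | [] => 0
  | true :: T => blockLen T + 2
  | false :: T => blockLen T + 1

/-- The number with the binary expansion `T1` or (if the flag is set) `T11`. -/
def wordVal (T : List Bool) (f : Bool) : ℕ :=
  if f then 4 * blockVal T + 3 else 2 * blockVal T + 1

theorem blockVal_append_true (P : List Bool) : blockVal (P ++ [true]) = 4 * blockVal P + 2 := by
  simp [blockVal]

theorem blockVal_append_false (P : List Bool) : blockVal (P ++ [false]) = 2 * blockVal P := by
  simp [blockVal]

theorem blockLen_append (P R : List Bool) : blockLen (P ++ R) = blockLen P + blockLen R := by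
  induction P with
  | nil => simp [blockLen]
  | cons t P ih => cases t <;> simp [blockLen, ih] <;> omega

theorem blockLen_replicate (c : ℕ) : blockLen (List.replicate c true) = 2 * c := by
  induction c with
  | zero => rfl
  | succ c ih => simp [List.replicate_succ, blockLen, ih]; ring

theorem blockVal_append (P R : List Bool) :
    blockVal (P ++ R) = 2 ^ blockLen R * blockVal P + blockVal R := by
  induction R using List.reverseRecOn with
  | nil => simp [blockVal, blockLen]
  | append_singleton R t ih =>
    rw [← List.append_assoc]
    cases t
    · rw [blockVal_append_false, blockVal_append_false, ih, blockLen_append]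
      simp only [blockLen]; ring
    · rw [blockVal_append_true, blockVal_append_true, ih, blockLen_append]
      simp only [blockLen]; ring

theorem blockVal_lt (T : List Bool) : blockVal T < 2 ^ blockLen T := by
  induction T using List.reverseRecOn with
  | nil => simp [blockVal, blockLen]
  | append_singleton R t ih =>
    rw [blockLen_append]
    cases t
    · rw [blockVal_append_false]; simp only [blockLen, pow_succ]; omega
    · rw [blockVal_append_true]; simp only [blockLen, pow_succ]; omega

theorem wordVal_append (P R : List Bool) (f : Bool) :
    wordVal (P ++ R) f = 2 ^ (blockLen R + f.toNat + 1) * blockVal P + wordVal R f := by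
  cases f <;> simp [wordVal, blockVal_append] <;> ring

theorem wordVal_lt (T : List Bool) (f : Bool) : wordVal T f < 2 ^ (blockLen T + f.toNat + 1) := by
  have := blockVal_lt T
  cases f <;> simp [wordVal, pow_succ] <;> omega

theorem wordVal_true_cons (R : List Bool) (f : Bool) :
    wordVal (true :: R) f = 2 ^ (blockLen R + f.toNat + 2) + wordVal R f := by
  rw [show true :: R = [true] ++ R by rfl, wordVal_append]
  simp [blockVal]; ring

theorem exists_blockVal (n : ℕ) : n % 2 = 0 → (∀ m, n / 2 ^ m % 4 ≠ 3) →
    ∃ T, n = blockVal T ∧ (T = [] ∨ ∃ R, T = true :: R) := by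
  induction n using Nat.strong_induction_on with
  | _ n ih =>
    intro h2 h3
    rcases Nat.eq_zero_or_pos n with rfl | hpos
    · exact ⟨[], rfl, Or.inl rfl⟩
    by_cases h4 : n % 4 = 0
    · obtain ⟨T, hT, hd⟩ := ih (n / 2) (by omega) (by omega) (fun m => by
        rw [Nat.div_div_eq_div_mul, mul_comm, ← pow_succ]; exact h3 _)
      refine ⟨T ++ [false], by rw [blockVal_append_false]; omega, ?_⟩
      rcases hd with rfl | ⟨R, rfl⟩
      · simp [blockVal] at hT; omega
      · exact Or.inr ⟨R ++ [false], rfl⟩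
    -- Here `n` ends in 10; the digit before that is not 1, so `n / 4` is again even.
    · have h1 := h3 1
      obtain ⟨T, hT, hd⟩ := ih (n / 4) (by omega) (by omega) (fun m => by
        rw [Nat.div_div_eq_div_mul, show 4 * 2 ^ m = 2 ^ (m + 2) by ring]; exact h3 _)
      refine ⟨T ++ [true], by rw [blockVal_append_true]; omega, ?_⟩
      rcases hd with rfl | ⟨R, rfl⟩
      · exact Or.inr ⟨[], rfl⟩
      · exact Or.inr ⟨R ++ [true], rfl⟩

theorem IsRecordSetter.exists_wordVal {v : ℕ} (hv : IsRecordSetter stern v) (h : 4 ≤ v) :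
    ∃ R f, v = wordVal (true :: R) f := by
  have hodd := hv.odd (by omega)
  have h3 := hv.not_one_one
  by_cases h2 : v / 2 % 2 = 0
  · obtain ⟨T, hT, hd⟩ := exists_blockVal (v / 2) h2 h3
    rcases hd with rfl | ⟨R, rfl⟩
    · simp [blockVal] at hT; omega
    · exact ⟨R, false, by simp only [wordVal]; simp; omega⟩
  · have := h3 0
    obtain ⟨T, hT, hd⟩ := exists_blockVal (v / 4) (by simp at this; omega) (fun m => by
        rw [show v / 4 = v / 2 / 2 by omega, Nat.div_div_eq_div_mul, ← pow_succ']; exact h3 _)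
    rcases hd with rfl | ⟨R, rfl⟩
    · simp [blockVal] at hT; omega
    · exact ⟨R, true, by simp only [wordVal]; simp; omega⟩

/-! ### Values of `stern` on words -/

/-- The value of `stern` at the number given by a list of blocks. -/
def sternL (T : List Bool) : ℕ := stern (blockVal T)

/-- The value of `stern` at the successor of the number given by a list of blocks. -/
def sternR (T : List Bool) : ℕ := stern (blockVal T + 1)

theorem sternL_nil : sternL [] = 0 := stern_zero

theorem sternR_nil : sternR [] = 1 := stern_one

theorem sternL_true (P : List Bool) : sternL (P ++ [true]) = sternL P + sternR P := by
  rw [sternL, blockVal_append_true, stern_four_mul_add_two, sternL, sternR]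

theorem sternR_true (P : List Bool) : sternR (P ++ [true]) = sternL P + 2 * sternR P := by
  rw [sternR, blockVal_append_true, stern_four_mul_add_three, sternL, sternR]

theorem sternL_false (P : List Bool) : sternL (P ++ [false]) = sternL P := by
  rw [sternL, blockVal_append_false, stern_two_mul, sternL]

theorem sternR_false (P : List Bool) : sternR (P ++ [false]) = sternL P + sternR P := by
  rw [sternR, blockVal_append_false, stern_two_mul_add_one, sternL, sternR]

theorem sternL_le_sternR (T : List Bool) : sternL T ≤ sternR T := by
  induction T using List.reverseRecOn with
  | nil => simp [sternL_nil]
  | append_singleton R t ih =>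
    cases t
    · rw [sternL_false, sternR_false]; omega
    · rw [sternL_true, sternR_true]; omega

theorem stern_wordVal_false (T : List Bool) : stern (wordVal T false) = sternL T + sternR T := by
  simp [wordVal, sternL, sternR, stern_two_mul_add_one]

theorem stern_wordVal_true (T : List Bool) :
    stern (wordVal T true) = sternL T + 2 * sternR T := by
  simp [wordVal, sternL, sternR, stern_four_mul_add_three]

/-- The block 10 acts by the matrix with rows (1, 1) and (1, 2), whose powers have Fibonacci
entries. The corner entry is `fib (2c + 1) - fib (2c)`; its negative part is moved to the left to
stay in the natural numbers. -/
theorem sternLR_replicate (P : List Bool) (c : ℕ) :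
    sternL (P ++ List.replicate c true) + Nat.fib (2 * c) * sternL P =
      Nat.fib (2 * c + 1) * sternL P + Nat.fib (2 * c) * sternR P ∧
    sternR (P ++ List.replicate c true) =
      Nat.fib (2 * c) * sternL P + Nat.fib (2 * c + 1) * sternR P := by
  induction c with
  | zero => simp
  | succ c ih =>
    obtain ⟨h1, h2⟩ := ih
    rw [List.replicate_succ', ← List.append_assoc, sternL_true, sternR_true, h2,
      show 2 * (c + 1) = 2 * c + 2 by ring, show 2 * c + 2 + 1 = 2 * c + 1 + 2 by ring,
      Nat.fib_add_two (n := 2 * c + 1), Nat.fib_add_two (n := 2 * c)]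
    constructor <;> linarith

theorem stern_wordVal_append_le (P R : List Bool) (f : Bool) :
    stern (wordVal (P ++ R) f) ≤ Nat.fib (blockLen R + f.toNat + 2) * sternR P +
      Nat.fib (blockLen R + f.toNat + 1) * sternL P := by
  rw [wordVal_append]
  exact stern_le_fib _ _ _ _ _ (wordVal_lt R f) (sternL_le_sternR P) le_rfl
    (by rw [add_comm]; rfl)

theorem fib_lt_stern_wordVal {P R : List Bool} {f : Bool}
    (h : IsRecordSetter stern (wordVal (P ++ true :: R) f)) :
    Nat.fib (blockLen R + f.toNat + 3) * (sternL P + sternR P) +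
      Nat.fib (blockLen R + f.toNat + 2) * sternL P < stern (wordVal (P ++ true :: R) f) := by
  refine h.fib_lt (m := blockLen R + f.toNat + 1) (r := wordVal R f) (p := blockVal P) ?_
  rw [wordVal_append, wordVal_true_cons]
  simp only [blockLen]
  ring

theorem stern_wordVal_replicate_false (P : List Bool) (c : ℕ) :
    stern (wordVal (P ++ List.replicate c true) false) =
      Nat.fib (2 * c + 1) * sternL P + Nat.fib (2 * c + 2) * sternR P := by
  obtain ⟨h1, h2⟩ := sternLR_replicate P c
  rw [stern_wordVal_false, Nat.fib_add_two]
  linarith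

theorem stern_wordVal_replicate_true (P : List Bool) (c : ℕ) :
    stern (wordVal (P ++ List.replicate c true) true) =
      Nat.fib (2 * c + 2) * sternL P + Nat.fib (2 * c + 3) * sternR P := by
  obtain ⟨h1, h2⟩ := sternLR_replicate P c
  rw [stern_wordVal_true, Nat.fib_add_two (n := 2 * c + 1), Nat.fib_add_two]
  linarith

/-- The ratios `fib (2c) / fib (2c + 1)` increase to the inverse golden ratio, which is below 5/8.
-/
theorem five_mul_fib_ge (c : ℕ) : 8 * Nat.fib (2 * c) ≤ 5 * Nat.fib (2 * c + 1) := by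
  induction c with
  | zero => simp
  | succ c ih =>
    rw [show 2 * (c + 1) = 2 * c + 2 by ring, show 2 * c + 2 + 1 = 2 * c + 1 + 2 by ring,
      Nat.fib_add_two (n := 2 * c + 1), Nat.fib_add_two (n := 2 * c)]
    omega

theorem fib_add_add_one (J c : ℕ) : Nat.fib (J + 2 * c + 1) =
    Nat.fib J * Nat.fib (2 * c) + Nat.fib (J + 1) * Nat.fib (2 * c + 1) := Nat.fib_add J (2 * c)

theorem fib_add_add_two (J c : ℕ) : Nat.fib (J + 2 * c + 2) =
    Nat.fib J * Nat.fib (2 * c + 1) +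
      Nat.fib (J + 1) * (Nat.fib (2 * c) + Nat.fib (2 * c + 1)) := by
  rw [← Nat.fib_add_two]; exact Nat.fib_add J (2 * c + 1)

/-- The exact pair is carried through the run of 10s and the following 0; only the digits after that
are estimated, by the Fibonacci bound. -/
theorem stern_wordVal_replicate_cons_le (P R : List Bool) (f : Bool) (c : ℕ) :
    stern (wordVal (P ++ (List.replicate c true ++ false :: R)) f) +
      (Nat.fib (blockLen R + f.toNat) + 2 * Nat.fib (blockLen R + f.toNat + 1)) *
        (Nat.fib (2 * c) * sternL P) ≤
    (Nat.fib (blockLen R + f.toNat) + 2 * Nat.fib (blockLen R + f.toNat + 1)) *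
      (Nat.fib (2 * c + 1) * sternL P + Nat.fib (2 * c) * sternR P) +
    (Nat.fib (blockLen R + f.toNat) + Nat.fib (blockLen R + f.toNat + 1)) *
      (Nat.fib (2 * c) * sternL P + Nat.fib (2 * c + 1) * sternR P) := by
  have h := stern_wordVal_append_le (P ++ List.replicate c true ++ [false]) R f
  obtain ⟨h1, h2⟩ := sternLR_replicate P c
  rw [sternL_false, sternR_false, Nat.fib_add_two] at h
  rw [show P ++ (List.replicate c true ++ false :: R) =
    P ++ List.replicate c true ++ [false] ++ R by simp, ← h1, ← h2]
  linarith

/-! ### Excluding words with too many blocks 0 -/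

/-- The bound behind the fact that a record-setter cannot have two further blocks `0` after a
prefix followed by `10`. -/
theorem IsRecordSetter.lt_of_two_false {P R : List Bool} {f : Bool} {c : ℕ}
    (h : IsRecordSetter stern
      (wordVal (P ++ true :: false :: (List.replicate c true ++ false :: R)) f)) :
    4 * (Nat.fib (blockLen R + f.toNat + 1) * Nat.fib (2 * c + 1) * sternL P) +
      (Nat.fib (blockLen R + f.toNat) + 2 * Nat.fib (blockLen R + f.toNat + 1)) *
        Nat.fib (2 * c) * sternL P + 2 * (Nat.fib (blockLen R + f.toNat) * Nat.fib (2 * c + 1)) *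
        sternL P <
    (Nat.fib (blockLen R + f.toNat) + 2 * Nat.fib (blockLen R + f.toNat + 1)) *
        Nat.fib (2 * c) * sternR P + Nat.fib (blockLen R + f.toNat) * Nat.fib (2 * c + 1) *
        sternR P := by
  have lo := fib_lt_stern_wordVal h
  have hi := stern_wordVal_replicate_cons_le (P ++ [true] ++ [false]) R f c
  simp only [List.append_assoc, List.cons_append, List.nil_append] at hi
  rw [← List.singleton_append (l := [false]), ← List.append_assoc, sternL_false, sternR_false,
    sternL_true, sternR_true] at hi
  have hN : blockLen (false :: (List.replicate c true ++ false :: R)) + f.toNat =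
      blockLen R + f.toNat + 2 * c + 2 := by
    simp only [blockLen, blockLen_append, blockLen_replicate]; ring
  have e1 := fib_add_add_one (blockLen R + f.toNat) c
  have e2 := fib_add_add_two (blockLen R + f.toNat) c
  rw [hN] at lo
  set J := blockLen R + f.toNat
  rw [show J + 2 * c + 2 + 3 = J + 2 * c + 3 + 2 by ring, Nat.fib_add_two (n := J + 2 * c + 3),
    show J + 2 * c + 3 + 1 = J + 2 * c + 2 + 2 by ring, Nat.fib_add_two (n := J + 2 * c + 2),
    show J + 2 * c + 3 = J + 2 * c + 1 + 2 by ring,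
    show J + 2 * c + 2 + 1 = J + 2 * c + 1 + 2 by ring,
    Nat.fib_add_two (n := J + 2 * c + 1), show J + 2 * c + 1 + 1 = J + 2 * c + 2 by ring, e1, e2]
    at lo
  linarith

/-- If `sternR P` were at most `2 * sternL P`, the inequality `lt_of_two_false` would fail
coefficientwise. A prefix `P` ending in 10 has that ratio (`replicate_succ_ratio`) and is thereby
excluded. -/
theorem IsRecordSetter.not_two_false {P R : List Bool} {f : Bool} {c : ℕ}
    (h : IsRecordSetter stern
      (wordVal (P ++ true :: false :: (List.replicate c true ++ false :: R)) f)) :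
    2 * sternL P < sternR P := by
  by_contra! hP
  have h1 := h.lt_of_two_false
  have hA : Nat.fib (2 * c) ≤ Nat.fib (2 * c + 1) := Nat.fib_le_fib_succ
  have hJ : Nat.fib (blockLen R + f.toNat) ≤ Nat.fib (blockLen R + f.toNat + 1) :=
    Nat.fib_le_fib_succ
  generalize Nat.fib (blockLen R + f.toNat) = e at *
  generalize Nat.fib (blockLen R + f.toNat + 1) = g at *
  generalize Nat.fib (2 * c) = A at *
  generalize Nat.fib (2 * c + 1) = B at *
  have h2 : (e + 2 * g) * A * sternR P ≤ (e + 2 * g) * A * (2 * sternL P) := by gcongr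
  have h3 : e * B * sternR P ≤ e * B * (2 * sternL P) := by gcongr
  have h4 : e * A * sternL P ≤ g * B * sternL P := by gcongr
  have h5 : g * A * sternL P ≤ g * B * sternL P := by gcongr
  have h6 := Nat.zero_le (g * B * sternL P)
  linarith

/-- With ratio at most 3 the inequality still fails as soon as `3 * fib J ≤ 2 * fib (J + 1)`, where
`J` is the tail length. This holds for every `J` except 1. The ratio 3 is that of the prefix 100. -/
theorem IsRecordSetter.tail_of_two_false {P R : List Bool} {f : Bool} {c : ℕ}
    (h : IsRecordSetter stern
      (wordVal (P ++ true :: false :: (List.replicate c true ++ false :: R)) f))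
    (hP : sternR P ≤ 3 * sternL P) : blockLen R + f.toNat = 1 := by
  by_contra hne
  have h1 := h.lt_of_two_false
  have hA := five_mul_fib_ge c
  have hJ : 3 * Nat.fib (blockLen R + f.toNat) ≤ 2 * Nat.fib (blockLen R + f.toNat + 1) := by
    generalize blockLen R + f.toNat = J at *
    rcases J with _ | _ | J
    · simp
    · omega
    · have e1 := Nat.fib_add_two (n := J)
      have e2 := Nat.fib_add_two (n := J + 1)
      have e3 := Nat.fib_le_fib_succ (n := J)
      rw [show J + 1 + 1 = J + 2 by ring] at *
      rw [e2]
      omega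
  generalize Nat.fib (blockLen R + f.toNat) = e at *
  generalize Nat.fib (blockLen R + f.toNat + 1) = g at *
  generalize Nat.fib (2 * c) = A at *
  obtain ⟨D, hD⟩ : ∃ D, Nat.fib (2 * c + 1) = A + D := ⟨Nat.fib (2 * c + 1) - A, by omega⟩
  rw [hD] at h1 hA
  have h2 : (e + 2 * g) * A * sternR P ≤ (e + 2 * g) * A * (3 * sternL P) := by gcongr
  have h3 : e * (A + D) * sternR P ≤ e * (A + D) * (3 * sternL P) := by gcongr
  have h4 : 3 * e * D * sternL P ≤ 2 * g * D * sternL P := by gcongr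
  have h5 : e * (3 * A) * sternL P ≤ e * (5 * D) * sternL P :=
    Nat.mul_le_mul_right _ (Nat.mul_le_mul_left _ (by omega))
  linarith

/-- For the empty prefix `sternL` vanishes and the ratio arguments say nothing. Instead the pair (1,
4) of the prefix 1000 is carried through a further 0 and compared with the optimum after deleting
the leading 1. -/
theorem IsRecordSetter.not_one_zero_zero_zero {R : List Bool} {f : Bool} {c : ℕ} :
    ¬ IsRecordSetter stern
      (wordVal (true :: false :: false :: (List.replicate c true ++ false :: R)) f) := by
  intro h
  have lo := fib_lt_stern_wordVal (P := []) h
  have hi := stern_wordVal_replicate_cons_le ([] ++ [true] ++ [false] ++ [false]) R f c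
  rw [sternL_false, sternR_false, sternL_false, sternR_false, sternL_true, sternR_true, sternL_nil,
    sternR_nil] at hi
  rw [sternL_nil, sternR_nil] at lo
  simp only [List.cons_append, List.nil_append] at hi lo
  have hN : blockLen (false :: false :: (List.replicate c true ++ false :: R)) + f.toNat =
      blockLen R + f.toNat + 2 * c + 3 := by
    simp only [blockLen, blockLen_append, blockLen_replicate]; ring
  have e1 := fib_add_add_one (blockLen R + f.toNat) c
  have e2 := fib_add_add_two (blockLen R + f.toNat) c
  have hA := five_mul_fib_ge c
  have hJ : Nat.fib (blockLen R + f.toNat) ≤ Nat.fib (blockLen R + f.toNat + 1) :=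
    Nat.fib_le_fib_succ
  rw [hN] at lo
  set J := blockLen R + f.toNat
  rw [show J + 2 * c + 3 + 3 = J + 2 * c + 4 + 2 by ring, Nat.fib_add_two (n := J + 2 * c + 4),
    show J + 2 * c + 4 + 1 = J + 2 * c + 3 + 2 by ring, Nat.fib_add_two (n := J + 2 * c + 3),
    show J + 2 * c + 3 + 1 = J + 2 * c + 2 + 2 by ring, Nat.fib_add_two (n := J + 2 * c + 2),
    show J + 2 * c + 3 = J + 2 * c + 1 + 2 by ring,
    show J + 2 * c + 2 + 1 = J + 2 * c + 1 + 2 by ring,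
    Nat.fib_add_two (n := J + 2 * c + 1), show J + 2 * c + 1 + 1 = J + 2 * c + 2 by ring, e1, e2]
    at lo
  generalize Nat.fib J = e at *
  generalize Nat.fib (J + 1) = g at *
  generalize Nat.fib (2 * c) = A at *
  obtain ⟨D, hD⟩ : ∃ D, Nat.fib (2 * c + 1) = A + D := ⟨Nat.fib (2 * c + 1) - A, by omega⟩
  rw [hD] at lo hi hA
  have h4 : e * A ≤ g * (2 * D) := by gcongr; omega
  linarith

/-- Each block 10 acts monotonically on the ratio of `sternL` to `sternR`; `c` blocks starting from
ratio 0 already give `fib (2c) / fib (2c + 1)`. -/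
theorem fib_mul_sternR_le (P : List Bool) (c d : ℕ) :
    Nat.fib (2 * c) * sternR (P ++ List.replicate (c + d) true) ≤
      Nat.fib (2 * c + 1) * sternL (P ++ List.replicate (c + d) true) := by
  induction c with
  | zero => simp
  | succ c ih =>
    rw [show c + 1 + d = c + d + 1 by ring, List.replicate_succ', ← List.append_assoc, sternL_true,
      sternR_true, show 2 * (c + 1) = 2 * c + 2 by ring, show 2 * c + 2 + 1 = 2 * c + 1 + 2 by ring,
      Nat.fib_add_two (n := 2 * c + 1), Nat.fib_add_two (n := 2 * c)]
    linarith

/-- Let `Q` be the part before the last two 10s preceding the 0. The value minus the bound from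
`fib_lt_stern_wordVal` equals `fib (2c) * sternR Q - fib (2c + 1) * sternL Q`, which is not positive
once `Q` ends in at least `c` blocks 10. -/
theorem IsRecordSetter.le_of_false {P : List Bool} {b c : ℕ}
    (h : IsRecordSetter stern
      (wordVal (P ++ (List.replicate (b + 2) true ++ false :: List.replicate c true)) false)) :
    b + 1 ≤ c := by
  by_contra! hbc
  obtain ⟨d, rfl⟩ := Nat.exists_eq_add_of_le (show c ≤ b by omega)
  have hc := fib_mul_sternR_le P c d
  rw [List.replicate_add _ 2, List.append_assoc, ← List.append_assoc] at h
  generalize P ++ List.replicate (c + d) true = Q at *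
  have hi := stern_wordVal_replicate_false (Q ++ [true] ++ [true] ++ [false]) c
  rw [sternL_false, sternR_false, sternL_true, sternR_true, sternL_true, sternR_true] at hi
  have e : Q ++ (List.replicate 2 true ++ false :: List.replicate c true) =
    Q ++ [true] ++ true :: (false :: List.replicate c true) := by simp [List.replicate_succ]
  rw [e] at h
  have lo := fib_lt_stern_wordVal h
  rw [show Q ++ [true] ++ [true] ++ [false] ++ List.replicate c true =
    Q ++ [true] ++ true :: (false :: List.replicate c true) by simp] at hi
  rw [hi, sternL_true, sternR_true] at lo
  simp only [blockLen, blockLen_replicate, Bool.toNat_false] at lo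
  rw [show 2 * c + 1 + 0 + 3 = 2 * c + 2 + 2 by ring, Nat.fib_add_two (n := 2 * c + 2),
    show 2 * c + 1 + 0 + 2 = 2 * c + 1 + 2 by ring, show 2 * c + 2 + 1 = 2 * c + 1 + 2 by ring,
    Nat.fib_add_two (n := 2 * c + 1), Nat.fib_add_two (n := 2 * c)] at lo
  linarith

theorem exists_eq_replicate_append (T : List Bool) :
    ∃ c, T = List.replicate c true ∨ ∃ R, T = List.replicate c true ++ false :: R := by
  induction T with
  | nil => exact ⟨0, Or.inl rfl⟩
  | cons t T ih =>
    cases t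
    · exact ⟨0, Or.inr ⟨T, rfl⟩⟩
    · obtain ⟨c, rfl | ⟨R, rfl⟩⟩ := ih
      · exact ⟨c + 1, Or.inl rfl⟩
      · exact ⟨c + 1, Or.inr ⟨R, rfl⟩⟩

theorem replicate_succ_ratio (P : List Bool) (c : ℕ) :
    sternR (P ++ List.replicate (c + 1) true) ≤ 2 * sternL (P ++ List.replicate (c + 1) true) := by
  rw [List.replicate_succ', ← List.append_assoc, sternL_true, sternR_true]
  omega

/-- The possible shapes of the block expansion of a record-setter. -/
theorem IsRecordSetter.shape {R : List Bool} {f : Bool}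
    (h : IsRecordSetter stern (wordVal (true :: R) f)) :
    (∃ b, true :: R = List.replicate (b + 1) true) ∨
    (∃ b c, true :: R = List.replicate (b + 1) true ++ false :: List.replicate c true ∧
      (f = false → b ≤ c)) ∨
    (∃ b c, true :: R = true :: false :: (List.replicate b true ++ false :: List.replicate c true) ∧
      (f = false → b ≤ c + 1)) ∨
    (∃ c, true :: R =
      true :: false :: true :: false :: (List.replicate c true ++ [false]) ∧ f = true) := by
  obtain ⟨b, rfl | ⟨R1, rfl⟩⟩ := exists_eq_replicate_append R
  · exact Or.inl ⟨b, rfl⟩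
  obtain ⟨c, rfl | ⟨R2, rfl⟩⟩ := exists_eq_replicate_append R1
  · refine Or.inr (Or.inl ⟨b, c, rfl, ?_⟩)
    rintro rfl
    rcases b with _ | b
    · omega
    · exact h.le_of_false (P := [])
  rcases b with _ | b
  swap
  · exfalso
    rw [show true :: (List.replicate (b + 1) true ++
        false :: (List.replicate c true ++ false :: R2)) =
        [] ++ List.replicate (b + 1) true ++
          true :: false :: (List.replicate c true ++ false :: R2) by
      rw [← List.cons_append, ← List.replicate_succ, List.replicate_succ' (n := b + 1)]; simp] at h
    -- At least two leading 10s: the prefix before the last of them ends in 10, so its ratio is at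
    -- most 2.
    exact absurd h.not_two_false (not_lt.mpr (replicate_succ_ratio [] b))
  simp only [List.replicate_zero, List.nil_append] at h ⊢
  obtain ⟨d, rfl | ⟨R3, rfl⟩⟩ := exists_eq_replicate_append R2
  · refine Or.inr (Or.inr (Or.inl ⟨c, d, rfl, ?_⟩))
    rintro rfl
    rcases c with _ | _ | c
    · omega
    · omega
    · have := h.le_of_false (P := [true, false])
      omega
  rcases c with _ | _ | c
  · exact absurd h IsRecordSetter.not_one_zero_zero_zero
  · refine Or.inr (Or.inr (Or.inr ?_))
    -- The tail length 1 leaves two words: ending in 011, which is allowed, or in 001, which is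
    -- refuted below.
    have h1 := IsRecordSetter.tail_of_two_false (P := [true, false]) h (by decide +kernel)
    rcases R3 with _ | ⟨_ | _, R3⟩ <;> cases f <;> simp [blockLen] at h1
    · exact ⟨d, rfl, rfl⟩
    · have hR : R3 = [] := by
        rcases R3 with _ | ⟨_ | _, R3⟩ <;> simp [blockLen] at h1 ⊢
      subst hR
      exfalso
      rcases d with _ | d
      -- The word is 100100001, that is 289, and 277 has at least its value.
      · exact absurd (h 277 (by decide)) (by decide +kernel)
      -- Regrouping at the last 10 of the run makes the tail after the two 0s empty, of length 0
      -- instead of 1.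
      · have h2 : IsRecordSetter stern (wordVal (([true, false, true, false] ++
            List.replicate d true) ++ true :: false :: (List.replicate 0 true ++ false :: []))
            false) := by
          simpa [List.replicate_succ'] using h
        have := h2.tail_of_two_false (by
          rcases d with _ | d
          · decide +kernel
          · exact (replicate_succ_ratio _ d).trans (by omega))
        simp [blockLen] at this
  · exfalso
    have h1 : IsRecordSetter stern (wordVal (([true, false] ++ List.replicate (c + 1) true) ++
        true :: false :: (List.replicate d true ++ false :: R3)) f) := by
      simpa [List.replicate_succ' (n := c + 1)] using h
    exact absurd h1.not_two_false (not_lt.mpr (replicate_succ_ratio [true, false] c))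

/-! ### From increasing chains of candidates to record-setters -/

/-- Both the arguments and the values of `stern` increase. -/
def SternLt (u v : ℕ) : Prop := u < v ∧ stern u < stern v

instance : IsTrans ℕ SternLt := ⟨fun _ _ _ h₁ h₂ => ⟨h₁.1.trans h₂.1, h₁.2.trans h₂.2⟩⟩

/-- For a candidate `v`, the least index `u ≤ v` maximizing `stern` on `[0, v]` is a record-setter.
It has `k` bits, because `stern` is at most `Nat.fib k` below `2 ^ (k - 1)`. So `u` is a candidate,
and monotonicity along the chain forces `u = v`. -/
theorem recordSetterList_eq_of_isChain {k a : ℕ} {l : List ℕ} (hk : 1 ≤ k)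
    (hl : (a :: l).IsChain SternLt) (ha : Nat.fib k < stern a)
    (hb : ∀ v ∈ a :: l, 2 ^ (k - 1) ≤ v ∧ v < 2 ^ k)
    (hrec : ∀ v, 2 ^ (k - 1) ≤ v → v < 2 ^ k → IsRecordSetter stern v → v ∈ a :: l) :
    recordSetterList k = a :: l := by
  have hp : (a :: l).Pairwise SternLt := List.isChain_iff_pairwise.mp hl
  have hfib : ∀ v ∈ a :: l, Nat.fib k < stern v := by
    intro v hv
    rcases List.mem_cons.mp hv with rfl | hv
    · exact ha
    · exact ha.trans ((List.pairwise_cons.mp hp).1 v hv).2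
  have hlt : ∀ u ∈ a :: l, ∀ v ∈ a :: l, u < v → stern u < stern v := by
    intro u hu v hv huv
    obtain ⟨i, hi, rfl⟩ := List.getElem_of_mem hu
    obtain ⟨j, hj, rfl⟩ := List.getElem_of_mem hv
    have hij := List.pairwise_iff_getElem.mp hp
    rcases lt_trichotomy i j with h | rfl | h
    · exact (hij i j hi hj h).2
    · exact absurd huv (lt_irrefl _)
    · exact absurd (hij j i hj hi h).1 (not_lt.mpr huv.le)
  have hset : recordSetters k = (a :: l).toFinset := by
    ext v
    rw [recordSetters, Finset.mem_filter, Finset.mem_Ico, List.mem_toFinset]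
    refine ⟨fun h => hrec v h.1.1 h.1.2 h.2, fun hv => ⟨hb v hv, ?_⟩⟩
    intro i hi
    obtain ⟨w, hw, hmax⟩ := Finset.exists_max_image (Finset.range (v + 1)) stern ⟨0, by simp⟩
    have hex : ∃ u, u ≤ v ∧ ∀ i ≤ v, stern i ≤ stern u :=
      ⟨w, by simpa [Nat.lt_succ_iff] using hw, fun i hi => hmax i (by simpa [Nat.lt_succ_iff] using hi)⟩
    classical
    obtain ⟨hu, hum⟩ := Nat.find_spec hex
    have hmin := fun m => Nat.find_min hex (m := m)
    generalize Nat.find hex = u at *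
    have hur : IsRecordSetter stern u := by
      intro j hj
      by_contra! hge
      exact hmin j hj ⟨hj.le.trans hu, fun i hi => (hum i hi).trans hge⟩
    have hu1 : 2 ^ (k - 1) ≤ u := by
      by_contra! hlt'
      have h1 := stern_le_fib_of_lt hlt'
      rw [Nat.sub_add_cancel hk] at h1
      exact absurd (hum v le_rfl) (not_le.mpr (h1.trans_lt (hfib v hv)))
    have hul := hrec u hu1 (hu.trans_lt (hb v hv).2) hur
    rcases hu.lt_or_eq with h | rfl
    · exact absurd (hum v le_rfl) (not_le.mpr (hlt u hul v hv h))
    · exact hur i hi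
  rw [recordSetterList, hset, List.toFinset_sort]
  · exact hp.imp fun h => h.1.le
  · exact hp.imp fun h => h.1.ne

theorem wordVal_lt_wordVal (P R R' : List Bool) (f f' : Bool)
    (h : blockLen R + f.toNat = blockLen R' + f'.toNat + 1) :
    wordVal (P ++ false :: R) f < wordVal (P ++ true :: R') f' := by
  rw [wordVal_append, wordVal_append, wordVal_true_cons]
  have h1 := wordVal_lt (false :: R) f
  simp only [blockLen] at h1 ⊢
  have h2 : wordVal (false :: R) f = wordVal R f := by
    have := wordVal_append [false] R f
    simpa [blockVal] using this
  have h3 := wordVal_lt R f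
  rw [show blockLen R + 1 + f.toNat = blockLen R' + 2 + f'.toNat by omega, h2]
  rw [show blockLen R + f.toNat + 1 = blockLen R' + f'.toNat + 2 by omega] at h3
  omega

/-- The values differ by `fib (2c + 1) * (sternR P - sternL P)`. -/
theorem sternLt_wordVal_false_true (P : List Bool) (c : ℕ) (h : sternL P < sternR P) :
    SternLt (wordVal (P ++ false :: List.replicate c true) false)
      (wordVal (P ++ List.replicate c true) true) := by
  constructor
  · rcases c with _ | c
    · simp only [List.replicate_zero, List.append_nil, wordVal, blockVal_append_false]
      simp; omega
    · exact wordVal_lt_wordVal _ _ _ _ _ (by simp [blockLen_replicate]; ring)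
  · rw [List.append_cons, stern_wordVal_replicate_false, stern_wordVal_replicate_true,
      sternL_false, sternR_false, Nat.fib_add_two (n := 2 * c + 1)]
    have : 0 < Nat.fib (2 * c + 1) := Nat.fib_pos.mpr (by omega)
    nlinarith

theorem sternLt_wordVal_true_false (P : List Bool) (h : sternL P < sternR P) :
    SternLt (wordVal (P ++ [false]) true) (wordVal (P ++ [true]) false) := by
  constructor
  · exact wordVal_lt_wordVal _ _ _ _ _ rfl
  · rw [stern_wordVal_true, stern_wordVal_false, sternL_false, sternR_false, sternL_true,
      sternR_true]
    omega

theorem sternL_lt_sternR (P : List Bool) (h : sternL P < sternR P) (e : ℕ) :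
    sternL (P ++ List.replicate e true) < sternR (P ++ List.replicate e true) := by
  induction e with
  | zero => simpa
  | succ e ih =>
    rw [List.replicate_succ', ← List.append_assoc, sternL_true, sternR_true]
    omega

/-- From a ratio below 1/2, blocks 10 raise `sternL / sternR` towards the inverse golden ratio from
below, while `fib (2c + 3) / fib (2c + 4)` lies above that limit. Hence `e` is unrestricted. -/
theorem fib_mul_sternL_lt_true (P : List Bool) (h : 2 * sternL P < sternR P) (c : ℕ) : ∀ e,
    Nat.fib (2 * c + 4) * sternL (P ++ List.replicate e true) <
      Nat.fib (2 * c + 3) * sternR (P ++ List.replicate e true) := by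
  induction c with
  | zero =>
    intro e
    rw [show Nat.fib (2 * 0 + 4) = 3 by rfl, show Nat.fib (2 * 0 + 3) = 2 by rfl]
    rcases e with _ | e
    · simp; omega
    · have := sternL_lt_sternR P (by omega) e
      rw [List.replicate_succ', ← List.append_assoc, sternL_true, sternR_true]
      omega
  | succ c ih =>
    intro e
    have e1 : Nat.fib (2 * (c + 1) + 3) = Nat.fib (2 * c + 3) + Nat.fib (2 * c + 4) := Nat.fib_add_two
    have e2 : Nat.fib (2 * (c + 1) + 4) = Nat.fib (2 * c + 4) + Nat.fib (2 * (c + 1) + 3) :=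
      Nat.fib_add_two
    rw [e2, e1]
    rcases e with _ | e
    · simp only [List.replicate_zero, List.append_nil]
      have : 0 < Nat.fib (2 * c + 3) := Nat.fib_pos.mpr (by omega)
      nlinarith
    · rw [List.replicate_succ', ← List.append_assoc, sternL_true, sternR_true]
      linarith [ih e]

/-- Now `fib (2c + 2) / fib (2c + 3)`, with `c = d + e`, is also below the limit, so the run before
the 0 must not be longer than `c`. This is the source of the bounds on `b` in the rows ending in a
single 1. -/
theorem fib_mul_sternL_lt_false (P : List Bool) (h : 2 * sternL P < sternR P) (d e : ℕ) :
    Nat.fib (2 * (d + e) + 3) * sternL (P ++ List.replicate e true) <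
      Nat.fib (2 * (d + e) + 2) * sternR (P ++ List.replicate e true) := by
  induction e with
  | zero =>
    simp only [List.replicate_zero, List.append_nil, add_zero]
    have e1 : Nat.fib (2 * d + 3) = Nat.fib (2 * d + 1) + Nat.fib (2 * d + 2) := Nat.fib_add_two
    have : 0 < Nat.fib (2 * d + 2) := Nat.fib_pos.mpr (by omega)
    have : Nat.fib (2 * d + 1) ≤ Nat.fib (2 * d + 2) := Nat.fib_le_fib_succ
    nlinarith
  | succ e ih =>
    have e1 : Nat.fib (2 * (d + (e + 1)) + 2) =
      Nat.fib (2 * (d + e) + 2) + Nat.fib (2 * (d + e) + 3) := Nat.fib_add_two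
    have e2 : Nat.fib (2 * (d + (e + 1)) + 3) =
      Nat.fib (2 * (d + e) + 3) + Nat.fib (2 * (d + (e + 1)) + 2) := Nat.fib_add_two
    rw [e2, e1, List.replicate_succ', ← List.append_assoc, sternL_true, sternR_true]
    linarith

/-- Moving the 0 one block to the right gains `fib (2c + 3) * sternR Q - fib (2c + 4) * sternL Q`,
where `Q` is `P` followed by `e` blocks 10. -/
theorem sternLt_swap_true (P : List Bool) (h : 2 * sternL P < sternR P) (c e : ℕ) :
    SternLt (wordVal (P ++ (List.replicate e true ++ false :: List.replicate (c + 1) true)) true)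
      (wordVal (P ++ (List.replicate (e + 1) true ++ false :: List.replicate c true)) true) := by
  have h1 := fib_mul_sternL_lt_true P h c e
  rw [List.replicate_succ' (n := e), List.append_assoc (List.replicate e true),
    List.singleton_append, ← List.append_assoc, ← List.append_assoc]
  generalize P ++ List.replicate e true = Q at *
  constructor
  · exact wordVal_lt_wordVal _ _ _ _ _ (by simp [blockLen, blockLen_replicate]; ring)
  · rw [show Q ++ false :: List.replicate (c + 1) true =
        Q ++ [false] ++ [true] ++ List.replicate c true by simp [List.replicate_succ],
      show Q ++ true :: false :: List.replicate c true =
        Q ++ [true] ++ [false] ++ List.replicate c true by simp,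
      stern_wordVal_replicate_true, stern_wordVal_replicate_true]
    simp only [sternL_false, sternR_false, sternL_true, sternR_true]
    have e2 : Nat.fib (2 * c + 4) = Nat.fib (2 * c + 2) + Nat.fib (2 * c + 3) := Nat.fib_add_two
    rw [e2] at h1
    linarith

theorem sternLt_swap_false (P : List Bool) (h : 2 * sternL P < sternR P) {c e : ℕ} (hc : e ≤ c) :
    SternLt (wordVal (P ++ (List.replicate e true ++ false :: List.replicate (c + 1) true)) false)
      (wordVal (P ++ (List.replicate (e + 1) true ++ false :: List.replicate c true)) false) := by
  obtain ⟨d, rfl⟩ := Nat.exists_eq_add_of_le' hc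
  have h1 := fib_mul_sternL_lt_false P h d e
  rw [List.replicate_succ' (n := e), List.append_assoc (List.replicate e true),
    List.singleton_append, ← List.append_assoc, ← List.append_assoc]
  generalize P ++ List.replicate e true = Q at *
  generalize d + e = c at *
  constructor
  · exact wordVal_lt_wordVal _ _ _ _ _ (by simp [blockLen, blockLen_replicate]; ring)
  · rw [show Q ++ false :: List.replicate (c + 1) true =
        Q ++ [false] ++ [true] ++ List.replicate c true by simp [List.replicate_succ],
      show Q ++ true :: false :: List.replicate c true =
        Q ++ [true] ++ [false] ++ List.replicate c true by simp,
      stern_wordVal_replicate_false, stern_wordVal_replicate_false]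
    simp only [sternL_false, sternR_false, sternL_true, sternR_true]
    have e2 : Nat.fib (2 * c + 3) = Nat.fib (2 * c + 1) + Nat.fib (2 * c + 2) := Nat.fib_add_two
    rw [e2] at h1
    linarith

/-! ### Digit strings of words -/

/-- The digits of a number given by blocks. -/
def wordStr (T : List Bool) (f : Bool) : List ℕ :=
  (T.map fun t => if t then [1, 0] else [0]).flatten ++ if f then [1, 1] else [1]

theorem ofDigits_reverse_blocks (T : List Bool) :
    Nat.ofDigits 2 ((T.map fun t => if t then [1, 0] else [0]).flatten).reverse = blockVal T := by
  induction T using List.reverseRecOn with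
  | nil => rfl
  | append_singleton T t ih =>
    cases t
    · rw [blockVal_append_false, ← ih]
      simp [Nat.ofDigits_cons]
    · rw [blockVal_append_true, ← ih]
      simp [Nat.ofDigits_cons]; ring

theorem binRep_wordVal (R : List Bool) (f : Bool) :
    binRep (wordVal (true :: R) f) = wordStr (true :: R) f := by
  have h : Nat.ofDigits 2 (wordStr (true :: R) f).reverse = wordVal (true :: R) f := by
    have := ofDigits_reverse_blocks (true :: R)
    cases f
    · simp only [wordVal, ← this, wordStr]
      simp [Nat.ofDigits_cons]; ring
    · simp only [wordVal, ← this, wordStr]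
      simp [Nat.ofDigits_cons]; ring
  rw [binRep, ← h, Nat.digits_ofDigits 2 (by norm_num), List.reverse_reverse]
  · intro d hd
    rw [List.mem_reverse, wordStr] at hd
    simp only [List.mem_append, List.mem_flatten, List.mem_map] at hd
    rcases hd with ⟨l, ⟨t, -, rfl⟩, hd⟩ | hd
    · cases t <;> simp at hd <;> omega
    · cases f <;> simp at hd <;> omega
  · intro hne
    rw [List.getLast_reverse]
    simp [wordStr]

theorem wordStr_cons (t : Bool) (T : List Bool) (f : Bool) :
    wordStr (t :: T) f = (if t then [1, 0] else [0]) ++ wordStr T f := by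
  simp [wordStr]

theorem wordStr_replicate_append (c : ℕ) (T : List Bool) (f : Bool) :
    wordStr (List.replicate c true ++ T) f = tens c ++ wordStr T f := by
  simp [wordStr, tens]

theorem wordStr_replicate (c : ℕ) (f : Bool) :
    wordStr (List.replicate c true) f = tens c ++ wordStr [] f := by
  simp [wordStr, tens]

/-! ### The candidate lists -/

/-- The block expansions of the record-setters with an even number `2 * n` of digits. -/
def evenWords (n : ℕ) : List (List Bool × Bool) :=
  (List.range' 0 (n - 3 + 1)).map
      (fun a => (true :: false :: (List.replicate a true ++
        false :: List.replicate (n - 3 - a) true), true)) ++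
  ((List.range' 1 (n / 2)).map
      (fun b => (List.replicate b true ++ false :: List.replicate (n - b - 1) true, false)) ++
  [(List.replicate (n - 1) true, true)])

/-- The block expansions of the record-setters with an odd number `2 * n + 1` of digits. -/
def oddWords (n : ℕ) : List (List Bool × Bool) :=
  (true :: false :: false :: List.replicate (n - 2) true, false) ::
  (true :: false :: true :: false :: (List.replicate (n - 4) true ++ [false]), true) ::
  ((List.range' 1 ((n + 1) / 2 - 1)).map
      (fun b => (true :: false :: (List.replicate b true ++
        false :: List.replicate (n - 2 - b) true), false)) ++
  ((List.range' 0 (n - 2 + 1)).map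
      (fun a => (List.replicate (a + 1) true ++
        false :: List.replicate (n - 2 - a) true, true)) ++
  [(List.replicate n true, false)]))

theorem isChain_map_range'_append {α : Type*} {r : α → α → Prop} {f : ℕ → α} {l : List α}
    (s n : ℕ) (h : ∀ i, s ≤ i → i < s + n → r (f i) (f (i + 1)))
    (hl : (f (s + n) :: l).IsChain r) :
    ((List.range' s (n + 1)).map f ++ l).IsChain r := by
  induction n generalizing s with
  | zero => simpa using hl
  | succ n ih =>
    have := ih (s + 1) (fun i h1 h2 => h i (by omega) (by omega))
      (by rwa [show s + 1 + n = s + (n + 1) by ring])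
    rw [List.range'_succ, List.range'_succ] at *
    simp only [List.map_cons, List.cons_append] at this ⊢
    exact List.isChain_cons_cons.mpr ⟨h s le_rfl (by omega), this⟩

theorem isChain_cons_map_range'_append {α : Type*} {r : α → α → Prop} {f : ℕ → α} {l : List α}
    {a : α} (s n : ℕ) (ha : r a (f s)) (h : ∀ i, s ≤ i → i < s + n → r (f i) (f (i + 1)))
    (hl : (f (s + n) :: l).IsChain r) :
    (a :: ((List.range' s (n + 1)).map f ++ l)).IsChain r := by
  have := isChain_map_range'_append s n h hl
  rw [List.range'_succ] at *
  simp only [List.map_cons, List.cons_append] at this ⊢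
  exact List.isChain_cons_cons.mpr ⟨ha, this⟩

theorem map_wordStr_evenWords (n : ℕ) :
    (evenWords n).map (fun w => wordStr w.1 w.2) = evenStrings n := by
  simp [evenWords, evenStrings, wordStr_cons, wordStr_replicate_append, wordStr_replicate,
    List.range_eq_range', Function.comp_def]
  simp [wordStr]

theorem map_wordStr_oddWords (n : ℕ) :
    (oddWords n).map (fun w => wordStr w.1 w.2) = oddStrings n := by
  simp [oddWords, oddStrings, wordStr_cons, wordStr_replicate_append, wordStr_replicate,
    List.range_eq_range', Function.comp_def]
  simp [wordStr]

theorem of_mem_evenWords {n : ℕ} (hn : 6 ≤ n) {w : List Bool × Bool} (h : w ∈ evenWords n) :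
    (∃ R, w.1 = true :: R) ∧ blockLen w.1 + w.2.toNat + 1 = 2 * n := by
  simp only [evenWords, List.mem_append, List.mem_map, List.mem_range'_1, List.mem_singleton] at h
  rcases h with ⟨a, ha, rfl⟩ | ⟨b, hb, rfl⟩ | rfl
  · refine ⟨⟨_, rfl⟩, ?_⟩
    simp [blockLen, blockLen_append, blockLen_replicate]; omega
  · obtain ⟨b, rfl⟩ := Nat.exists_eq_add_of_le' hb.1
    refine ⟨⟨_, rfl⟩, ?_⟩
    simp [blockLen, blockLen_append, blockLen_replicate]; omega
  · obtain ⟨n, rfl⟩ := Nat.exists_eq_add_of_le' hn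
    refine ⟨⟨_, rfl⟩, ?_⟩
    simp [blockLen_replicate]; omega

theorem of_mem_oddWords {n : ℕ} (hn : 6 ≤ n) {w : List Bool × Bool} (h : w ∈ oddWords n) :
    (∃ R, w.1 = true :: R) ∧ blockLen w.1 + w.2.toNat + 1 = 2 * n + 1 := by
  simp only [oddWords, List.mem_append, List.mem_cons, List.mem_map, List.mem_range'_1,
    List.not_mem_nil, or_false] at h
  rcases h with rfl | rfl | ⟨b, hb, rfl⟩ | ⟨a, ha, rfl⟩ | rfl
  · refine ⟨⟨_, rfl⟩, ?_⟩
    simp [blockLen, blockLen_replicate]; omega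
  · refine ⟨⟨_, rfl⟩, ?_⟩
    simp [blockLen, blockLen_append, blockLen_replicate]; omega
  · refine ⟨⟨_, rfl⟩, ?_⟩
    simp [blockLen, blockLen_append, blockLen_replicate]; omega
  · refine ⟨⟨_, rfl⟩, ?_⟩
    simp [blockLen, blockLen_append, blockLen_replicate]; omega
  · obtain ⟨n, rfl⟩ := Nat.exists_eq_add_of_le' hn
    refine ⟨⟨_, rfl⟩, ?_⟩
    simp [blockLen_replicate]

/-- Modulo 2 the length is the number of blocks 0 plus the final digits, so parity decides between
the endings 1 and 11 for each shape, and discards the family with three 0s. -/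
theorem IsRecordSetter.mem_evenWords {n : ℕ} (hn : 6 ≤ n) {R : List Bool} {f : Bool}
    (h : IsRecordSetter stern (wordVal (true :: R) f))
    (hlen : blockLen (true :: R) + f.toNat + 1 = 2 * n) : (true :: R, f) ∈ evenWords n := by
  simp only [evenWords, List.mem_append, List.mem_map, List.mem_range'_1, List.mem_singleton]
  rcases h.shape with ⟨b, e⟩ | ⟨b, c, e, hbc⟩ | ⟨b, c, e, hbc⟩ | ⟨c, e, rfl⟩ <;> rw [e] at hlen ⊢ <;>
    simp only [blockLen, blockLen_append, blockLen_replicate] at hlen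
  · cases f <;> simp at hlen
    · omega
    · exact Or.inr (Or.inr (by rw [show b + 1 = n - 1 by omega]))
  · cases f <;> simp at hlen hbc
    · exact Or.inr (Or.inl ⟨b + 1, by omega, by rw [show n - (b + 1) - 1 = c by omega]⟩)
    · omega
  · cases f <;> simp at hlen hbc
    · omega
    · exact Or.inl ⟨b, by omega, by rw [show n - 3 - b = c by omega]⟩
  · simp at hlen; omega

theorem IsRecordSetter.mem_oddWords {n : ℕ} (hn : 6 ≤ n) {R : List Bool} {f : Bool}
    (h : IsRecordSetter stern (wordVal (true :: R) f))
    (hlen : blockLen (true :: R) + f.toNat + 1 = 2 * n + 1) : (true :: R, f) ∈ oddWords n := by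
  simp only [oddWords, List.mem_append, List.mem_cons, List.mem_map, List.mem_range'_1,
    List.not_mem_nil, or_false]
  rcases h.shape with ⟨b, e⟩ | ⟨b, c, e, hbc⟩ | ⟨b, c, e, hbc⟩ | ⟨c, e, rfl⟩ <;> rw [e] at hlen ⊢ <;>
    simp only [blockLen, blockLen_append, blockLen_replicate] at hlen
  · cases f <;> simp at hlen
    · exact Or.inr (Or.inr (Or.inr (Or.inr (by rw [show b + 1 = n by omega]))))
    · omega
  · cases f <;> simp at hlen hbc
    · omega
    · exact Or.inr (Or.inr (Or.inr (Or.inl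
        ⟨b, by omega, by rw [show n - 2 - b = c by omega]⟩)))
  · cases f <;> simp at hlen hbc
    · rcases b with _ | b
      · exact Or.inl (by rw [show n - 2 = c by omega]; rfl)
      · exact Or.inr (Or.inr (Or.inl
          ⟨b + 1, by omega, by rw [show n - 2 - (b + 1) = c by omega]⟩))
    · omega
  · simp at hlen
    exact Or.inr (Or.inl (by rw [show n - 4 = c by omega]))

theorem wordVal_mem_Ico (R : List Bool) (f : Bool) :
    2 ^ (blockLen (true :: R) + f.toNat) ≤ wordVal (true :: R) f ∧
      wordVal (true :: R) f < 2 ^ (blockLen (true :: R) + f.toNat + 1) := by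
  refine ⟨?_, wordVal_lt _ _⟩
  rw [wordVal_true_cons, blockLen, show blockLen R + 2 + f.toNat = blockLen R + f.toNat + 2 by ring]
  omega

theorem recordSetterList_eq_map_wordVal {k : ℕ} (hk : 3 ≤ k) {w : List Bool × Bool}
    {l : List (List Bool × Bool)}
    (hl : ((w :: l).map fun w => wordVal w.1 w.2).IsChain SternLt)
    (hw : Nat.fib k < stern (wordVal w.1 w.2))
    (hmem : ∀ w' ∈ w :: l, (∃ R, w'.1 = true :: R) ∧ blockLen w'.1 + w'.2.toNat + 1 = k)
    (hrec : ∀ R f, IsRecordSetter stern (wordVal (true :: R) f) →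
      blockLen (true :: R) + f.toNat + 1 = k → (true :: R, f) ∈ w :: l) :
    recordSetterList k = (w :: l).map (fun w => wordVal w.1 w.2) := by
  rw [List.map_cons] at hl ⊢
  refine recordSetterList_eq_of_isChain (by omega) hl hw ?_ ?_
  · intro v hv
    obtain ⟨⟨T, f⟩, h, rfl⟩ := List.mem_map.mp
      (show v ∈ (w :: l).map (fun w => wordVal w.1 w.2) from hv)
    obtain ⟨⟨R, rfl⟩, hlen⟩ := hmem _ h
    simp only at hlen ⊢
    rw [← hlen]
    exact wordVal_mem_Ico R f
  · intro v h1 h2 hv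
    have h4 : 4 ≤ v := le_trans (Nat.pow_le_pow_right (n := 2) (by norm_num)
      (show 2 ≤ k - 1 by omega)) h1
    obtain ⟨R, f, rfl⟩ := hv.exists_wordVal h4
    obtain ⟨h5, h6⟩ := wordVal_mem_Ico R f
    have h7 := (Nat.pow_lt_pow_iff_right (a := 2) (by norm_num)).mp (h1.trans_lt h6)
    have h8 := (Nat.pow_lt_pow_iff_right (a := 2) (by norm_num)).mp (h5.trans_lt h2)
    exact List.mem_map_of_mem (f := fun w : List Bool × Bool => wordVal w.1 w.2)
      (hrec R f hv (by omega))

theorem map_binRep_wordVal {l : List (List Bool × Bool)} (h : ∀ w ∈ l, ∃ R, w.1 = true :: R) :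
    (l.map fun w => wordVal w.1 w.2).map binRep = l.map fun w => wordStr w.1 w.2 := by
  rw [List.map_map]
  refine List.map_congr_left fun w hw => ?_
  obtain ⟨R, hR⟩ := h w hw
  simp only [Function.comp, hR, binRep_wordVal]

theorem isChain_evenWords {n : ℕ} (hn : 6 ≤ n) :
    ((evenWords n).map fun w => wordVal w.1 w.2).IsChain SternLt := by
  rw [List.isChain_map]
  obtain ⟨n, rfl⟩ := Nat.exists_eq_add_of_le' hn
  refine isChain_map_range'_append 0 _ ?_ ?_
  · intro a _ ha
    obtain ⟨c, hc⟩ : ∃ c, n + 6 - 3 - a = c + 1 := ⟨n + 6 - 3 - a - 1, by omega⟩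
    simp only [hc, show n + 6 - 3 - (a + 1) = c by omega]
    exact sternLt_swap_true [true, false] (by decide +kernel) c a
  · rw [show (n + 6) / 2 = ((n + 6) / 2 - 1) + 1 by omega]
    refine isChain_cons_map_range'_append 1 _ ?_ ?_ ?_
    -- Junction of the rows: the last block 0 before 11 becomes 10, and the ending becomes 1.
    · rw [Nat.zero_add, Nat.sub_self, show n + 6 - 1 - 1 = n + 6 - 3 + 1 by omega]
      have := sternLt_wordVal_true_false ([true, false] ++ List.replicate (n + 6 - 3) true)
        (sternL_lt_sternR _ (by decide +kernel) _)
      rw [List.append_assoc, List.append_assoc, ← List.replicate_succ'] at this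
      exact this
    · intro b h1 h2
      obtain ⟨c, hc⟩ : ∃ c, n + 6 - b - 1 = c + 1 := ⟨n + 6 - b - 1 - 1, by omega⟩
      simp only [hc, show n + 6 - (b + 1) - 1 = c by omega]
      exact sternLt_swap_false [] (by decide +kernel) (show b ≤ c by omega)
    · refine List.isChain_cons_cons.mpr ⟨?_, List.isChain_singleton _⟩
      have := sternLt_wordVal_false_true (List.replicate (1 + ((n + 6) / 2 - 1)) true)
        (n + 6 - (1 + ((n + 6) / 2 - 1)) - 1)
        (by simpa using sternL_lt_sternR [] (by decide +kernel) (1 + ((n + 6) / 2 - 1)))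
      rw [← List.replicate_add, show 1 + ((n + 6) / 2 - 1) +
        (n + 6 - (1 + ((n + 6) / 2 - 1)) - 1) = n + 6 - 1 by omega] at this
      exact this

theorem sternLt_oddWords_first (n : ℕ) :
    SternLt (wordVal ([true, false] ++ false :: List.replicate (n + 4) true) false)
      (wordVal ([true, false] ++ true :: false :: (List.replicate (n + 2) true ++ [false])) true) := by
  constructor
  · exact wordVal_lt_wordVal _ _ _ _ _
      (by simp [blockLen, blockLen_append, blockLen_replicate]; ring)
  · rw [List.append_cons, stern_wordVal_replicate_false,
      show [true, false] ++ true :: false :: (List.replicate (n + 2) true ++ [false]) =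
        [true, false, true, false] ++ List.replicate (n + 2) true ++ [false] by simp,
      stern_wordVal_true, sternL_false, sternR_false, sternL_false, sternR_false]
    obtain ⟨h1, h2⟩ := sternLR_replicate [true, false, true, false] (n + 2)
    rw [show sternL [true, false, true, false] = 4 by decide +kernel,
      show sternR [true, false, true, false] = 11 by decide +kernel] at h1 h2
    rw [show sternL [true, false] = 1 by decide +kernel,
      show sternR [true, false] = 3 by decide +kernel, h2]
    have e1 : Nat.fib (2 * (n + 2) + 2) = Nat.fib (2 * (n + 2)) + Nat.fib (2 * (n + 2) + 1) :=
      Nat.fib_add_two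
    have e2 : Nat.fib (2 * (n + 2) + 3) = Nat.fib (2 * (n + 2) + 1) + Nat.fib (2 * (n + 2) + 2) :=
      Nat.fib_add_two
    have e3 : Nat.fib (2 * (n + 2) + 4) = Nat.fib (2 * (n + 2) + 2) + Nat.fib (2 * (n + 2) + 3) :=
      Nat.fib_add_two
    have e4 : Nat.fib (2 * (n + 4) + 1) = Nat.fib (2 * (n + 2) + 3) + Nat.fib (2 * (n + 2) + 4) :=
      Nat.fib_add_two
    have e5 : Nat.fib (2 * (n + 4) + 2) = Nat.fib (2 * (n + 2) + 4) + Nat.fib (2 * (n + 4) + 1) :=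
      Nat.fib_add_two
    have e6 : Nat.fib (2 * (n + 2) + 1) = Nat.fib (2 * n + 3) + Nat.fib (2 * (n + 2)) :=
      Nat.fib_add_two
    have e7 : Nat.fib (2 * (n + 2)) = Nat.fib (2 * n + 2) + Nat.fib (2 * n + 3) :=
      Nat.fib_add_two
    -- The two values differ by exactly `3 * fib (2n + 2)`. At length 11 the same formula gives `3 *
    -- fib 0 = 0`, a tie.
    have : 0 < Nat.fib (2 * n + 2) := Nat.fib_pos.mpr (by omega)
    omega

theorem isChain_oddWords {n : ℕ} (hn : 6 ≤ n) :
    ((oddWords n).map fun w => wordVal w.1 w.2).IsChain SternLt := by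
  rw [List.isChain_map]
  obtain ⟨n, rfl⟩ := Nat.exists_eq_add_of_le' hn
  refine List.isChain_cons_cons.mpr ⟨sternLt_oddWords_first n, ?_⟩
  rw [show (n + 6 + 1) / 2 - 1 = ((n + 6 + 1) / 2 - 2) + 1 by omega]
  refine isChain_cons_map_range'_append 1 _ ?_ ?_ ?_
  · have := sternLt_wordVal_true_false ([true, false, true, false] ++ List.replicate (n + 2) true)
      (sternL_lt_sternR _ (by decide +kernel) _)
    rw [List.append_assoc, List.append_assoc, ← List.replicate_succ'] at this
    exact this
  · intro b h1 h2
    obtain ⟨c, hc⟩ : ∃ c, n + 6 - 2 - b = c + 1 := ⟨n + 6 - 2 - b - 1, by omega⟩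
    simp only [hc, show n + 6 - 2 - (b + 1) = c by omega]
    exact sternLt_swap_false [true, false] (by decide +kernel) (show b ≤ c by omega)
  · refine isChain_cons_map_range'_append 0 _ ?_ ?_ ?_
    · generalize hb : 1 + ((n + 6 + 1) / 2 - 2) = b
      have := sternLt_wordVal_false_true ([true, false] ++ List.replicate b true)
        (n + 6 - 2 - b) (sternL_lt_sternR _ (by decide +kernel) _)
      rw [List.append_assoc, List.append_assoc, ← List.replicate_add,
        show b + (n + 6 - 2 - b) = n + 6 - 2 - 0 by omega] at this
      exact this
    · intro a _ ha
      obtain ⟨c, hc⟩ : ∃ c, n + 6 - 2 - a = c + 1 := ⟨n + 6 - 2 - a - 1, by omega⟩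
      simp only [hc, show n + 6 - 2 - (a + 1) = c by omega]
      exact sternLt_swap_true [] (by decide +kernel) c (a + 1)
    · refine List.isChain_cons_cons.mpr ⟨?_, List.isChain_singleton _⟩
      have := sternLt_wordVal_true_false (List.replicate (n + 5) true)
        (by simpa using sternL_lt_sternR [] (by decide +kernel) (n + 5))
      rw [← List.replicate_succ'] at this
      rw [Nat.zero_add, Nat.sub_self]
      exact this

theorem recordSetterList_even {n : ℕ} (hn : 6 ≤ n) :
    recordSetterList (2 * n) = (evenWords n).map fun w => wordVal w.1 w.2 := by
  obtain ⟨n, rfl⟩ := Nat.exists_eq_add_of_le' hn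
  obtain ⟨l, hl⟩ : ∃ l, evenWords (n + 6) =
      ([true, false] ++ [false] ++ List.replicate (n + 3) true, true) :: l := ⟨_, rfl⟩
  have hmem := fun w => of_mem_evenWords (w := w) hn
  have hrec := fun R f => IsRecordSetter.mem_evenWords hn (R := R) (f := f)
  have hc := isChain_evenWords hn
  rw [hl] at *
  refine recordSetterList_eq_map_wordVal (by omega) hc ?_ hmem hrec
  rw [stern_wordVal_replicate_true, show sternL ([true, false] ++ [false]) = 1 by decide +kernel,
      show sternR ([true, false] ++ [false]) = 4 by decide +kernel]
  have e1 : Nat.fib (2 * (n + 3) + 2) = Nat.fib (2 * (n + 3)) + Nat.fib (2 * (n + 3) + 1) :=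
    Nat.fib_add_two
  have e2 : Nat.fib (2 * (n + 3) + 3) = Nat.fib (2 * (n + 3) + 1) + Nat.fib (2 * (n + 3) + 2) :=
    Nat.fib_add_two
  have e3 : Nat.fib (2 * (n + 3) + 4) = Nat.fib (2 * (n + 3) + 2) + Nat.fib (2 * (n + 3) + 3) :=
    Nat.fib_add_two
  have e4 : Nat.fib (2 * (n + 3) + 5) = Nat.fib (2 * (n + 3) + 3) + Nat.fib (2 * (n + 3) + 4) :=
    Nat.fib_add_two
  have e5 : Nat.fib (2 * (n + 6)) = Nat.fib (2 * (n + 3) + 4) + Nat.fib (2 * (n + 3) + 5) :=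
    Nat.fib_add_two
  -- The first candidate exceeds `fib k` by exactly this number.
  have : 0 < Nat.fib (2 * (n + 3) + 1) := Nat.fib_pos.mpr (by omega)
  omega

theorem recordSetterList_odd {n : ℕ} (hn : 6 ≤ n) :
    recordSetterList (2 * n + 1) = (oddWords n).map fun w => wordVal w.1 w.2 := by
  obtain ⟨n, rfl⟩ := Nat.exists_eq_add_of_le' hn
  obtain ⟨l, hl⟩ : ∃ l, oddWords (n + 6) =
      ([true, false] ++ [false] ++ List.replicate (n + 4) true, false) :: l := ⟨_, rfl⟩
  have hmem := fun w => of_mem_oddWords (w := w) hn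
  have hrec := fun R f => IsRecordSetter.mem_oddWords hn (R := R) (f := f)
  have hc := isChain_oddWords hn
  rw [hl] at *
  refine recordSetterList_eq_map_wordVal (by omega) hc ?_ hmem hrec
  rw [stern_wordVal_replicate_false, show sternL ([true, false] ++ [false]) = 1 by decide +kernel,
      show sternR ([true, false] ++ [false]) = 4 by decide +kernel]
  have e1 : Nat.fib (2 * (n + 4) + 2) = Nat.fib (2 * (n + 4)) + Nat.fib (2 * (n + 4) + 1) :=
    Nat.fib_add_two
  have e2 : Nat.fib (2 * (n + 4) + 3) = Nat.fib (2 * (n + 4) + 1) + Nat.fib (2 * (n + 4) + 2) :=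
    Nat.fib_add_two
  have e3 : Nat.fib (2 * (n + 4) + 4) = Nat.fib (2 * (n + 4) + 2) + Nat.fib (2 * (n + 4) + 3) :=
    Nat.fib_add_two
  have e4 : Nat.fib (2 * (n + 6) + 1) = Nat.fib (2 * (n + 4) + 3) + Nat.fib (2 * (n + 4) + 4) :=
    Nat.fib_add_two
  have : 0 < Nat.fib (2 * (n + 4)) := Nat.fib_pos.mpr (by omega)
  omega

theorem card_recordSetters_eq_length (k : ℕ) :
    (recordSetters k).card = (recordSetterList k).length := by
  simp [recordSetterList]

theorem card_recordSetters {k : ℕ} (hk : 12 ≤ k) :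
    ((recordSetters k).card : ℤ) = ⌊(3 * (k : ℚ)) / 4⌋ - (-1) ^ k := by
  have hfloor : ⌊(3 * (k : ℚ)) / 4⌋ = ((3 * k / 4 : ℕ) : ℤ) := by
    rw [show (3 * (k : ℚ)) / 4 = ((3 * k : ℕ) : ℚ) / ((4 : ℕ) : ℚ) by push_cast; ring]
    exact Rat.floor_natCast_div_natCast _ _
  rw [hfloor, card_recordSetters_eq_length]
  obtain ⟨n, rfl | rfl⟩ := Nat.even_or_odd' k
  · rw [recordSetterList_even (by omega), Even.neg_one_pow (even_two_mul n)]
    simp [evenWords]; omega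
  · rw [recordSetterList_odd (by omega), Odd.neg_one_pow (odd_two_mul_add_one n)]
    simp [oddWords]; omega

/-! ### Computation for lengths below 12 -/

/-- The record-setters among the `c` numbers from `v` on, given the maximum `m` of `s` below `v`. -/
def scanRecords (s : ℕ → ℕ) : ℕ → ℕ → ℕ → List ℕ
  | 0, _, _ => []
  | c + 1, v, m => if m < s v then v :: scanRecords s c (v + 1) (s v) else scanRecords s c (v + 1) m

/-- The invariant is that `m` is the running maximum; being attained, it makes `m < s v` equivalent
to being a record. -/
theorem scanRecords_eq_filter (s : ℕ → ℕ) (c : ℕ) : ∀ v m, (∀ i < v, s i ≤ m) →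
    (∃ i < v, s i = m) →
    scanRecords s c v m = (List.range' v c).filter (fun v => decide (IsRecordSetter s v)) := by
  induction c with
  | zero => intros; rfl
  | succ c ih =>
    intro v m hle ⟨j, hj, hjm⟩
    have hiff : IsRecordSetter s v ↔ m < s v :=
      ⟨fun h => hjm ▸ h j hj, fun h i hi => (hle i hi).trans_lt h⟩
    rw [scanRecords, List.range'_succ, List.filter_cons]
    by_cases h : m < s v
    · rw [if_pos h, if_pos (by simpa [hiff] using h), ih (v + 1) (s v)]
      · intro i hi
        rcases Nat.lt_succ_iff_lt_or_eq.mp hi with h' | rfl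
        · exact ((hle i h').trans_lt h).le
        · exact le_rfl
      · exact ⟨v, by omega, rfl⟩
    · rw [if_neg h, if_neg (by simpa [hiff] using h), ih (v + 1) m]
      · intro i hi
        rcases Nat.lt_succ_iff_lt_or_eq.mp hi with h' | rfl
        · exact hle i h'
        · omega
      · exact ⟨j, by omega, hjm⟩

/-- The pair `(stern n, stern (n + 1))`, computed with `b` recursive calls for `n < 2 ^ b`. -/
def sternPair : ℕ → ℕ → ℕ × ℕ
  | 0, _ => (0, 1)
  | b + 1, n =>
    let p := sternPair b (n / 2)
    if n % 2 = 0 then (p.1, p.1 + p.2) else (p.1 + p.2, p.2)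

theorem sternPair_eq (b : ℕ) : ∀ n < 2 ^ b, sternPair b n = (stern n, stern (n + 1)) := by
  induction b with
  | zero =>
    intro n hn
    have : n = 0 := by simpa using hn
    subst this
    simp [sternPair, stern_zero, stern_one]
  | succ b ih =>
    intro n hn
    rw [pow_succ] at hn
    rw [sternPair, ih (n / 2) (by omega)]
    obtain ⟨q, rfl | rfl⟩ := Nat.even_or_odd' n
    · rw [show 2 * q / 2 = q by omega, if_pos (by omega), stern_two_mul, stern_two_mul_add_one]
    · rw [show (2 * q + 1) / 2 = q by omega, if_neg (by omega), stern_two_mul_add_one,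
        show 2 * q + 1 + 1 = 2 * (q + 1) by ring, stern_two_mul]

theorem scanRecords_congr {s t : ℕ → ℕ} (c : ℕ) : ∀ v m, (∀ i < v + c, s i = t i) →
    scanRecords s c v m = scanRecords t c v m := by
  induction c with
  | zero => intros; rfl
  | succ c ih =>
    intro v m h
    simp only [scanRecords]
    rw [h v (by omega), ih _ _ fun i hi => h i (by omega), ih _ _ fun i hi => h i (by omega)]

theorem filter_isRecordSetter_range' :
    (List.range' 1 2047).filter (fun v => decide (IsRecordSetter stern v)) =
      [1, 3, 5, 9, 11, 19, 21, 35, 37, 43, 69, 73, 75, 83, 85, 139, 147, 149, 165, 171,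
        277, 293, 299, 331, 339, 341, 555, 587, 595, 597, 661, 683,
        1109, 1173, 1189, 1195, 1323, 1355, 1363, 1365] := by
  -- All indices are below `2 ^ 11`, so `sternPair` with 11 halvings computes each value.
  rw [← scanRecords_eq_filter stern 2047 1 0 (by simp [stern_zero]) ⟨0, by simp [stern_zero]⟩,
    scanRecords_congr (t := fun v => (sternPair 11 v).1) 2047 1 0
      fun i hi => by rw [sternPair_eq 11 i (by norm_num; omega)]]
  decide +kernel

theorem recordSetterList_eq_filter {k : ℕ} (h1 : 1 ≤ k) (h12 : k < 12) :
    recordSetterList k =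
      ((List.range' 1 2047).filter (fun v => decide (IsRecordSetter stern v))).filter
        (fun v => decide (2 ^ (k - 1) ≤ v ∧ v < 2 ^ k)) := by
  have hp : (((List.range' 1 2047).filter (fun v => decide (IsRecordSetter stern v))).filter
      (fun v => decide (2 ^ (k - 1) ≤ v ∧ v < 2 ^ k))).Pairwise (· < ·) :=
    ((List.pairwise_lt_range' (s := 1) (n := 2047)).filter _).filter _
  have hset : recordSetters k = (((List.range' 1 2047).filter
      (fun v => decide (IsRecordSetter stern v))).filter
        (fun v => decide (2 ^ (k - 1) ≤ v ∧ v < 2 ^ k))).toFinset := by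
    ext v
    have h0 : 0 < 2 ^ (k - 1) := by positivity
    have h2 : 2 ^ k ≤ 2 ^ 11 := Nat.pow_le_pow_right (by norm_num) (by omega)
    simp only [recordSetters, Finset.mem_filter, Finset.mem_Ico, List.mem_toFinset,
      List.mem_filter, List.mem_range'_1, decide_eq_true_eq]
    constructor
    · rintro ⟨⟨h3, h4⟩, h5⟩
      exact ⟨⟨⟨by omega, by omega⟩, h5⟩, h3, h4⟩
    · rintro ⟨⟨_, h5⟩, h3, h4⟩
      exact ⟨⟨h3, h4⟩, h5⟩
  rw [recordSetterList, hset, List.toFinset_sort]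
  · exact hp.imp fun h => h.le
  · exact hp.imp fun h => h.ne

theorem map_recordSetterList_small {k : ℕ} (h1 : 1 ≤ k) (h12 : k < 12) :
    (recordSetterList k).map (fun v => (binRep v, v)) = smallTable k := by
  rw [recordSetterList_eq_filter h1 h12, filter_isRecordSetter_range']
  interval_cases k <;> decide +kernel

theorem theorem1 :
    (∀ k : ℕ, 1 ≤ k → k < 12 →
      (recordSetterList k).map (fun v => (binRep v, v)) = smallTable k) ∧
    (∀ n : ℕ, 12 ≤ 2 * n →
      (recordSetterList (2 * n)).map binRep = evenStrings n) ∧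
    (∀ n : ℕ, 12 ≤ 2 * n + 1 →
      (recordSetterList (2 * n + 1)).map binRep = oddStrings n) ∧
    (∀ k : ℕ, 12 ≤ k →
      ((recordSetters k).card : ℤ) = ⌊(3 * (k : ℚ)) / 4⌋ - (-1) ^ k) := by
  refine ⟨fun k => map_recordSetterList_small, fun n hn => ?_, fun n hn => ?_,
    fun k => card_recordSetters⟩
  · rw [recordSetterList_even (by omega),
      map_binRep_wordVal fun w hw => (of_mem_evenWords (by omega) hw).1, map_wordStr_evenWords]
  · rw [recordSetterList_odd (by omega),
      map_binRep_wordVal fun w hw => (of_mem_oddWords (by omega) hw).1, map_wordStr_oddWords]
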